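/- For a function $f:[0,1]\to[0,\infty)$ let $\mathbf{E}_f$ be the relation on $[0,1]^\omega$ given by $$(x_n)_{n<\omega}\,\mathbf{E}_f\,(y_n)_{n<\omega}\iff\sum_{n<\omega}f(|y_n-x_n|)<\infty,$$ and for $p\ge 1$ let $\mathbb{R}^\omega/\ell_p$ be the equivalence relation on $\mathbb{R}^\omega$ relating $x$ and $y$ iff $x-y\in\ell_p$, that is, $\sum_{n<\omega}|x_n-y_n|^p<\infty$. For relations $E$, $F$ on Polish spaces $X$, $Y$, write $E\le_B F$ if there is a Borel function $\theta:X\to Y$ with $x\,E\,\hat x\iff\theta(x)\,F\,\theta(\hat x)$ for all $x,\hat x\in X$. Let $\beta>\alpha\ge 1$, $0<\delta<1$ and $\lambda=2^{\alpha-\beta}$. Let $(u_n)_{n<\omega}$ be a sequence of real numbers such that $u_0=u_1=1$ and, for each $n>1$, $$u_n=u_{n-1}\quad\text{or}\quad u_n=\lambda u_{n-1}+(1-\lambda)\max_{1\le i\le n-1}\{\delta u_iu_{n-i}\}.$$ Let $\varphi:[0,1]\to[0,\infty)$ be a continuous increasing (not necessarily strictly) function with $\varphi(1/2^n)=u_n$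 for each $n<\omega$, and set $f(x)=x^\alpha\varphi(x)$ for $x\in[0,1]$. Then $\mathbf{E}_f$ is an equivalence relation and $$\mathbb{R}^\omega/\ell_1\le_B\mathbf{E}_f\le_B\mathbb{R}^\omega/\ell_\beta.$$ -/

import Mathlib

open scoped NNReal ENNReal unitInterval

noncomputable section

/-- `E` is Borel reducible to `F`, for relations on Polish spaces. -/
def BorelReducible {X Y : Type*}
    [TopologicalSpace X] [PolishSpace X] [MeasurableSpace X] [BorelSpace X]
    [TopologicalSpace Y] [PolishSpace Y] [MeasurableSpace Y] [BorelSpace Y]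
    (E : X → X → Prop) (F : Y → Y → Prop) : Prop :=
  ∃ θ : X → Y, Measurable θ ∧ ∀ x x' : X, E x x' ↔ F (θ x) (θ x')

/-- The relation `ℝ^ω / ℓ_p` on real sequences: `x` and `y` are related iff `x - y ∈ ℓ_p`. -/
def lpRel (p : ℝ≥0∞) (x y : ℕ → ℝ) : Prop :=
  Memℓp (x - y) p

/-- The point `|y - x|` of `[0,1]`, for `x` and `y` in `[0,1]`. -/
def unitAbsSub (y x : I) : I :=
  ⟨|(y : ℝ) - (x : ℝ)|, abs_nonneg _,
    abs_le.mpr ⟨by linarith [y.2.1, x.2.2], by linarith [y.2.2, x.2.1]⟩⟩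

/-- The relation `E_f` on `[0,1]^ω`: `x` and `y` are related iff `∑ f(|y_n - x_n|) < ∞`. -/
def sumRel (f : I → ℝ≥0) (x y : ℕ → I) : Prop :=
  Summable fun n => f (unitAbsSub (y n) (x n))

/-- The point `1 / 2 ^ n` of `[0,1]`. -/
def dyadicPoint (n : ℕ) : I :=
  ⟨1 / 2 ^ n, by positivity, by
    rw [div_le_one (by positivity)]
    exact one_le_pow₀ (by norm_num)⟩

/-- `u 0 = u 1 = 1` and, for each `n > 1` (written as `m + 2`), either `u n = u (n - 1)` or
`u n = lam * u (n - 1) + (1 - lam) * max {δ * u i * u (n - i) | 1 ≤ i ≤ n - 1}`.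
The choice between the two alternatives may depend on `n`. -/
structure IsRecursiveSeq (δ lam : ℝ) (u : ℕ → ℝ) : Prop where
  zero : u 0 = 1
  one : u 1 = 1
  step : ∀ m : ℕ, u (m + 2) = u (m + 1) ∨
    u (m + 2) = lam * u (m + 1) + (1 - lam) *
      (Finset.Icc 1 (m + 1)).sup' (Finset.nonempty_Icc.mpr (Nat.le_add_left 1 m))
        (fun i => δ * u i * u (m + 2 - i))

/-- The function `x ↦ x ^ α * φ x` on `[0,1]`. -/
def powMul (α : ℝ) (φ : I → ℝ≥0) (x : I) : ℝ≥0 :=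
  unitInterval.toNNReal x ^ α * φ x

end

open scoped NNReal ENNReal unitInterval

/-! Write `F` for `f` as a function of distance. Only its dyadic ratios matter: `F (2^-(k+1)) / F
(2^-k)` lies between `2^-β`, since the recursion gives `u (n+1) ≥ λ * u n` and `2^-α * λ = 2^-β`,
and `1/2`, since `u` is antitone and `α ≥ 1` (`isDyadicallyRegular_powMul`). A reduction needs only
countably many coordinate maps whose total target cost is comparable to the source cost
(`borelReducible_costRel`). The maps are waves of frequency `2^k`: at distance about `2^-K`, those
with `k ≤ K` are essentially linear and the others are merely bounded (`waveCost_le`,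
`le_waveCost`). To reach `ℓ_β`, the waves are weighted so that the low frequencies sum to `F
(2^-K)`. To reduce `ℓ₁`, waves of amplitude `2^-k` are repeated so that about `2^-K / F (2^-K)`
copies have frequency at most `2^K`. The ratio bounds make the weights and multiplicities
nonnegative and the tails geometric. -/

/-! ### Borel reductions and cost relations -/

theorem BorelReducible.trans {X Y Z : Type*}
    [TopologicalSpace X] [PolishSpace X] [MeasurableSpace X] [BorelSpace X]
    [TopologicalSpace Y] [PolishSpace Y] [MeasurableSpace Y] [BorelSpace Y]
    [TopologicalSpace Z] [PolishSpace Z] [MeasurableSpace Z] [BorelSpace Z]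
    {E : X → X → Prop} {F : Y → Y → Prop} {G : Z → Z → Prop}
    (h₁ : BorelReducible E F) (h₂ : BorelReducible F G) : BorelReducible E G := by
  obtain ⟨θ, hθ, h⟩ := h₁
  obtain ⟨η, hη, h'⟩ := h₂
  exact ⟨η ∘ θ, hη.comp hθ, fun x x' => (h x x').trans (h' _ _)⟩

/-- A relation that is Borel reducible to an equivalence relation is an equivalence relation. -/
theorem BorelReducible.equivalence {X Y : Type*}
    [TopologicalSpace X] [PolishSpace X] [MeasurableSpace X] [BorelSpace X]
    [TopologicalSpace Y] [PolishSpace Y] [MeasurableSpace Y] [BorelSpace Y]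
    {E : X → X → Prop} {F : Y → Y → Prop}
    (h : BorelReducible E F) (hF : Equivalence F) : Equivalence E := by
  obtain ⟨θ, -, h⟩ := h
  exact ⟨fun x => (h x x).2 (hF.refl _), fun hxy => (h _ _).2 (hF.symm ((h _ _).1 hxy)),
    fun hxy hyz => (h _ _).2 (hF.trans ((h _ _).1 hxy) ((h _ _).1 hyz))⟩

theorem equivalence_lpRel (p : ℝ≥0∞) : Equivalence (lpRel p) := by
  refine ⟨fun x => ?_, fun {x y} h => ?_, fun {x y z} h h' => ?_⟩
  · simpa [lpRel] using (zero_memℓp : Memℓp (0 : ℕ → ℝ) p)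
  · simpa [lpRel] using Memℓp.neg h
  · simpa [lpRel] using Memℓp.add h h'

/-- The relation on sequences whose coordinatewise costs have a finite sum. -/
def costRel {X : Type*} (a : X → X → ℝ≥0∞) (x y : ℕ → X) : Prop :=
  ∑' n, a (x n) (y n) ≠ ⊤

/-- Countably many coordinate functions that transform the cost `a` into a cost comparable with
the total cost `b` induce a Borel reduction. -/
theorem borelReducible_costRel {X Z ι : Type*}
    [TopologicalSpace X] [PolishSpace X] [MeasurableSpace X] [BorelSpace X]
    [TopologicalSpace Z] [PolishSpace Z] [MeasurableSpace Z] [BorelSpace Z] [Countable ι] [Infinite ι]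
    {a : X → X → ℝ≥0∞} {b : Z → Z → ℝ≥0∞} (g : ι → X → Z) (hg : ∀ i, Measurable (g i))
    {c C : ℝ≥0∞} (hc : c ≠ 0) (hC : C ≠ ⊤)
    (hl : ∀ x y, c * a x y ≤ ∑' i, b (g i x) (g i y))
    (hu : ∀ x y, ∑' i, b (g i x) (g i y) ≤ C * a x y) :
    BorelReducible (costRel a) (costRel b) := by
  obtain ⟨_⟩ := nonempty_denumerable (ℕ × ι)
  let e : ℕ ≃ ℕ × ι := (Denumerable.eqv (ℕ × ι)).symm
  refine ⟨fun x m => g (e m).2 (x (e m).1), ?_, fun x y => ?_⟩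
  · exact measurable_pi_lambda _ fun m => (hg _).comp (measurable_pi_apply _)
  · have hsum : ∑' m, b (g (e m).2 (x (e m).1)) (g (e m).2 (y (e m).1)) =
        ∑' n, ∑' i, b (g i (x n)) (g i (y n)) := by
      rw [← ENNReal.tsum_prod (f := fun n i => b (g i (x n)) (g i (y n)))]
      exact e.tsum_eq fun p : ℕ × ι => b (g p.2 (x p.1)) (g p.2 (y p.1))
    unfold costRel
    rw [hsum]
    constructor
    · intro h
      refine ne_top_of_le_ne_top (ENNReal.mul_ne_top hC h) ?_
      rw [← ENNReal.tsum_mul_left]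
      exact ENNReal.tsum_le_tsum fun n => hu _ _
    · intro h h'
      refine h (top_unique ?_)
      calc ⊤ = c * ∑' n, a (x n) (y n) := by rw [h', ENNReal.mul_top hc]
        _ = ∑' n, c * a (x n) (y n) := ENNReal.tsum_mul_left.symm
        _ ≤ _ := ENNReal.tsum_le_tsum fun n => hl _ _

theorem sumRel_eq_costRel (f : I → ℝ≥0) :
    sumRel f = costRel fun x y => (f (unitAbsSub y x) : ℝ≥0∞) := by
  ext x y
  exact ENNReal.tsum_coe_ne_top_iff_summable.symm

theorem lpRel_eq_costRel {β : ℝ} (hβ : 0 < β) :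
    lpRel (ENNReal.ofReal β) = costRel fun x y => ENNReal.ofReal (|x - y| ^ β) := by
  ext x y
  have h : (ENNReal.ofReal β).toReal = β := ENNReal.toReal_ofReal hβ.le
  have hp : 0 < (ENNReal.ofReal β).toReal := by rwa [h]
  unfold lpRel costRel
  rw [memℓp_gen_iff hp, h]
  have hs : ∀ n, 0 ≤ |x n - y n| ^ β := fun n => Real.rpow_nonneg (abs_nonneg _) _
  constructor
  · intro hsum
    exact (Summable.tsum_ofReal_ne_top hsum)
  · intro hne
    have := ENNReal.summable_toReal hne
    simpa [ENNReal.toReal_ofReal (hs _)] using this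

/-! ### Cutting the line into unit intervals -/

/-- Clamping keeps exactly the part of the interval in the `j`-th unit cell; the cells tile the
line, so these costs add up to the distance. -/
theorem ofReal_projIcc_sub (x y : ℝ) (hxy : x ≤ y) (j : ℤ) :
    ENNReal.ofReal |(Set.projIcc 0 1 zero_le_one (x - j) : ℝ) -
        (Set.projIcc 0 1 zero_le_one (y - j) : ℝ)| =
      MeasureTheory.volume (Set.Ioc x y ∩ Set.Ioc (j : ℝ) (j + 1)) := by
  have hmax : ∀ t : ℝ, ENNReal.ofReal t = ENNReal.ofReal (max 0 t) := fun t => by simp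
  rw [Set.Ioc_inter_Ioc, Real.volume_Ioc, hmax (_ - _)]
  simp only [Set.coe_projIcc]
  rw [abs_sub_comm, abs_of_nonneg (sub_nonneg.2 (by gcongr))]
  congr 1
  simp only [max_def, min_def]
  split_ifs <;> linarith

theorem tsum_ofReal_projIcc_sub (x y : ℝ) :
    ∑' j : ℤ, ENNReal.ofReal |(Set.projIcc 0 1 zero_le_one (x - j) : ℝ) -
        (Set.projIcc 0 1 zero_le_one (y - j) : ℝ)| = ENNReal.ofReal |x - y| := by
  wlog hxy : x ≤ y generalizing x y
  · rw [abs_sub_comm, ← this y x (le_of_not_ge hxy)]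
    simp only [abs_sub_comm]
  simp_rw [ofReal_projIcc_sub x y hxy]
  rw [← MeasureTheory.measure_iUnion, ← Set.inter_iUnion, iUnion_Ioc_intCast, Set.inter_univ,
    Real.volume_Ioc, abs_sub_comm, abs_of_nonneg (sub_nonneg.2 hxy)]
  · exact (Set.pairwise_disjoint_Ioc_intCast ℝ).mono fun i j h =>
      h.mono Set.inter_subset_right Set.inter_subset_right
  · exact fun j => measurableSet_Ioc.inter measurableSet_Ioc

theorem borelReducible_lpRel_one_unitInterval :
    BorelReducible (lpRel 1) (costRel fun x y : I => ENNReal.ofReal |(x : ℝ) - y|) := by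
  rw [← ENNReal.ofReal_one, lpRel_eq_costRel one_pos]
  refine borelReducible_costRel (ι := ℤ) (fun j x => Set.projIcc 0 1 zero_le_one (x - j))
    (fun j => (continuous_projIcc.comp (by fun_prop)).measurable) one_ne_zero ENNReal.one_ne_top
    (fun x y => ?_) (fun x y => ?_) <;>
  simp [tsum_ofReal_projIcc_sub]

/-! ### Waves of dyadic frequencies -/

/-- Two waves of values in `[0,1]`, a quarter of a period apart. -/
noncomputable def wave (b : Bool) (x : ℝ) : ℝ :=
  if b then (1 + Real.cos x) / 2 else (1 + Real.sin x) / 2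

theorem wave_mem (b : Bool) (x : ℝ) : wave b x ∈ Set.Icc (0 : ℝ) 1 := by
  cases b <;> simp only [wave, Set.mem_Icc, if_true, Bool.false_eq_true, if_false] <;>
  constructor <;>
  linarith [Real.neg_one_le_cos x, Real.cos_le_one x, Real.neg_one_le_sin x, Real.sin_le_one x]

theorem continuous_wave (b : Bool) : Continuous (wave b) := by
  unfold wave
  cases b <;> simp only [if_true, Bool.false_eq_true, if_false] <;> fun_prop

theorem abs_wave_sub_le_one (b : Bool) (x y : ℝ) : |wave b x - wave b y| ≤ 1 := by
  have hx := wave_mem b x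
  have hy := wave_mem b y
  exact abs_le.2 ⟨by linarith [hx.1, hy.2], by linarith [hx.2, hy.1]⟩

theorem abs_wave_sub_eq (b : Bool) (x y : ℝ) : |wave b x - wave b y| =
    |if b then Real.sin ((x + y) / 2) else Real.cos ((x + y) / 2)| * |Real.sin ((x - y) / 2)| := by
  rw [← abs_mul]
  cases b
  · rw [show wave false x - wave false y = (Real.sin x - Real.sin y) / 2 by simp [wave]; ring,
      Real.sin_sub_sin]
    congr 1; simp; ring
  · rw [show wave true x - wave true y = (Real.cos x - Real.cos y) / 2 by simp [wave]; ring,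
      Real.cos_sub_cos, ← abs_neg]
    congr 1; simp; ring

theorem abs_wave_sub_le (b : Bool) (x y : ℝ) : |wave b x - wave b y| ≤ |x - y| := by
  rw [abs_wave_sub_eq]
  have h1 : |if b then Real.sin ((x + y) / 2) else Real.cos ((x + y) / 2)| ≤ 1 := by
    cases b
    · simpa using Real.abs_cos_le_one _
    · simpa using Real.abs_sin_le_one _
  have h2 : |Real.sin ((x - y) / 2)| ≤ |(x - y) / 2| := Real.abs_sin_le_abs
  rw [abs_div, abs_two] at h2
  nlinarith [abs_nonneg (Real.sin ((x - y) / 2)), abs_nonneg (x - y)]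

/-- Sine and cosine of the midpoint cannot both be small, so one of the two phases always detects
the distance. -/
theorem exists_le_abs_wave_sub {x y : ℝ} (h : |x - y| ≤ 1) :
    ∃ b, |x - y| / 8 ≤ |wave b x - wave b y| := by
  have hs : |x - y| / 4 ≤ |Real.sin ((x - y) / 2)| := by
    have h0 : 0 ≤ |x - y| := abs_nonneg _
    have h1 := Real.mul_le_sin (x := |x - y| / 2) (by positivity)
      (by linarith [Real.pi_gt_three])
    have h2 : |x - y| / 4 ≤ 2 / Real.pi * (|x - y| / 2) := by
      rw [div_mul_div_comm, div_le_div_iff₀ (by norm_num) (by positivity)]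
      nlinarith [Real.pi_lt_four]
    have h3 : |Real.sin ((x - y) / 2)| = |Real.sin (|x - y| / 2)| := by
      rcases abs_cases (x - y) with ⟨h, -⟩ | ⟨h, -⟩
      · rw [h]
      · rw [h, neg_div, Real.sin_neg, abs_neg]
    rw [h3]
    exact (h2.trans h1).trans (le_abs_self _)
  have key : 1 / 2 ≤ |Real.sin ((x + y) / 2)| ∨ 1 / 2 ≤ |Real.cos ((x + y) / 2)| := by
    by_contra! hcon
    have := Real.sin_sq_add_cos_sq ((x + y) / 2)
    rw [← sq_abs (Real.sin _), ← sq_abs (Real.cos _)] at this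
    nlinarith [abs_nonneg (Real.sin ((x + y) / 2)), abs_nonneg (Real.cos ((x + y) / 2))]
  rcases key with hk | hk
  · refine ⟨true, ?_⟩
    rw [abs_wave_sub_eq]
    simp only [if_true]
    nlinarith [abs_nonneg (x - y)]
  · refine ⟨false, ?_⟩
    rw [abs_wave_sub_eq]
    simp only [Bool.false_eq_true, if_false]
    nlinarith [abs_nonneg (x - y)]

/-- The total cost of the waves of all dyadic frequencies. -/
noncomputable def waveCost (H : ℕ → ℝ → ℝ≥0∞) (x y : ℝ) : ℝ≥0∞ :=
  ∑' p : ℕ × Bool, H p.1 |wave p.2 (2 ^ p.1 * x) - wave p.2 (2 ^ p.1 * y)|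

theorem waveCost_eq (H : ℕ → ℝ → ℝ≥0∞) (x y : ℝ) : waveCost H x y =
    ∑' k, (H k |wave true (2 ^ k * x) - wave true (2 ^ k * y)| +
      H k |wave false (2 ^ k * x) - wave false (2 ^ k * y)|) := by
  unfold waveCost
  rw [ENNReal.tsum_prod (f := fun k b => H k |wave b (2 ^ k * x) - wave b (2 ^ k * y)|)]
  simp [tsum_fintype]

theorem abs_two_pow_mul_sub (k : ℕ) (x y : ℝ) :
    |2 ^ k * x - 2 ^ k * y| = 2 ^ k * |x - y| := by
  rw [← mul_sub, abs_mul, abs_of_pos (by positivity)]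

theorem waveCost_le {H : ℕ → ℝ → ℝ≥0∞} (hH : ∀ k, MonotoneOn (H k) (Set.Ici 0)) {x y : ℝ} {K : ℕ}
    (h : |x - y| ≤ (1 / 2) ^ K) : waveCost H x y ≤
      2 * (∑ k ∈ Finset.range (K + 1), H k (2 ^ k * (1 / 2) ^ K) + ∑' j, H (j + (K + 1)) 1) := by
  rw [waveCost_eq, ← ENNReal.summable.sum_add_tsum_nat_add' (k := K + 1), mul_add,
    Finset.mul_sum, ← ENNReal.tsum_mul_left]
  refine add_le_add (Finset.sum_le_sum fun k _ => ?_) (ENNReal.tsum_le_tsum fun j => ?_)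
  · have hb : ∀ b, H k |wave b (2 ^ k * x) - wave b (2 ^ k * y)| ≤ H k (2 ^ k * (1 / 2) ^ K) := by
      refine fun b => hH k (Set.mem_Ici.2 (abs_nonneg _)) (Set.mem_Ici.2 (by positivity)) ?_
      refine (abs_wave_sub_le _ _ _).trans ?_
      rw [abs_two_pow_mul_sub]
      gcongr
    rw [two_mul]
    exact add_le_add (hb _) (hb _)
  · have hb : ∀ b, H (j + (K + 1)) |wave b (2 ^ (j + (K + 1)) * x) -
        wave b (2 ^ (j + (K + 1)) * y)| ≤ H (j + (K + 1)) 1 := fun b =>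
      hH _ (Set.mem_Ici.2 (abs_nonneg _)) (Set.mem_Ici.2 zero_le_one) (abs_wave_sub_le_one _ _ _)
    rw [two_mul]
    exact add_le_add (hb _) (hb _)

/-- In `K + 4`, one halving comes from the lower bound on the distance and three from the factor `1
/ 8` of `exists_le_abs_wave_sub`. -/
theorem le_waveCost {H : ℕ → ℝ → ℝ≥0∞} (hH : ∀ k, MonotoneOn (H k) (Set.Ici 0)) {x y : ℝ} {K : ℕ}
    (h : |x - y| ≤ (1 / 2) ^ K) (h' : (1 / 2) ^ (K + 1) ≤ |x - y|) :
    ∑ k ∈ Finset.range (K + 1), H k (2 ^ k * (1 / 2) ^ (K + 4)) ≤ waveCost H x y := by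
  rw [waveCost_eq]
  refine le_trans (Finset.sum_le_sum fun k hk => ?_) (ENNReal.sum_le_tsum (Finset.range (K + 1)))
  have hkK : k ≤ K := Nat.lt_succ_iff.1 (Finset.mem_range.1 hk)
  have hle : |2 ^ k * x - 2 ^ k * y| ≤ 1 := by
    rw [abs_two_pow_mul_sub]
    calc (2 : ℝ) ^ k * |x - y| ≤ 2 ^ K * (1 / 2) ^ K := by
          gcongr
          norm_num
      _ = 1 := by rw [← mul_pow]; norm_num
  obtain ⟨b, hb⟩ := exists_le_abs_wave_sub hle
  have hHb : H k (2 ^ k * (1 / 2) ^ (K + 4)) ≤ H k |wave b (2 ^ k * x) - wave b (2 ^ k * y)| := by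
    refine hH k (Set.mem_Ici.2 (by positivity)) (Set.mem_Ici.2 (abs_nonneg _)) (le_trans ?_ hb)
    rw [abs_two_pow_mul_sub, mul_div_assoc]
    gcongr
    rw [show K + 4 = (K + 1) + 3 by ring, pow_add]
    linarith
  cases b
  · exact hHb.trans le_add_self
  · exact hHb.trans le_self_add

/-! ### Dyadically regular functions -/

/-- A nondecreasing function whose value at `1 / 2 ^ (k + 1)` lies between `q` and `1 / 2` times
its value at `1 / 2 ^ k`. -/
structure IsDyadicallyRegular (q : ℝ) (F : ℝ → ℝ) : Prop where
  pos : 0 < q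
  mono : Monotone F
  zero : F 0 = 0
  one : F 1 = 1
  mul_le : ∀ k, q * F ((1 / 2) ^ k) ≤ F ((1 / 2) ^ (k + 1))
  le_half : ∀ k, F ((1 / 2) ^ (k + 1)) ≤ F ((1 / 2) ^ k) / 2

theorem tsum_ofReal_geometric {a : ℝ} (ha : 0 ≤ a) :
    ∑' j : ℕ, ENNReal.ofReal (a / 2 / 2 ^ j) = ENNReal.ofReal a := by
  rw [← ENNReal.ofReal_tsum_of_nonneg (fun j => by positivity) (hasSum_geometric_two' a).summable,
    (hasSum_geometric_two' a).tsum_eq]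

theorem exists_dyadic_bounds {x y : I} (h : x ≠ y) :
    ∃ K : ℕ, (1 / 2 : ℝ) ^ (K + 1) < |(x : ℝ) - y| ∧ |(x : ℝ) - y| ≤ (1 / 2) ^ K := by
  refine exists_nat_pow_near_of_lt_one ?_ ?_ (by norm_num) (by norm_num)
  · exact abs_pos.2 (sub_ne_zero.2 fun e => h (Subtype.ext e))
  · exact abs_le.2 ⟨by linarith [x.2.1, y.2.2], by linarith [x.2.2, y.2.1]⟩

theorem waveCost_self {H : ℕ → ℝ → ℝ≥0∞} (h : ∀ k, H k 0 = 0) (x : ℝ) : waveCost H x x = 0 := by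
  simp [waveCost, h]

namespace IsDyadicallyRegular

variable {q : ℝ} {F : ℝ → ℝ}

theorem dyadic_pos (hF : IsDyadicallyRegular q F) (k : ℕ) : 0 < F ((1 / 2) ^ k) := by
  induction k with
  | zero => simp [hF.one]
  | succ k ih => exact (mul_pos hF.pos ih).trans_le (hF.mul_le k)

theorem pow_mul_le (hF : IsDyadicallyRegular q F) (k j : ℕ) : q ^ j * F ((1 / 2) ^ k) ≤ F ((1 / 2) ^ (k + j)) := by
  induction j with
  | zero => simp
  | succ j ih =>
    refine le_trans ?_ (hF.mul_le (k + j))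
    rw [pow_succ', mul_assoc]
    exact mul_le_mul_of_nonneg_left ih hF.pos.le

theorem le_half_pow (hF : IsDyadicallyRegular q F) (k j : ℕ) :
    F ((1 / 2) ^ (j + k)) ≤ F ((1 / 2) ^ k) / 2 ^ j := by
  induction j with
  | zero => simp
  | succ j ih =>
    have := hF.le_half (j + k)
    rw [show j + 1 + k = j + k + 1 by ring, pow_succ (2 : ℝ), ← div_div]
    linarith

end IsDyadicallyRegular

/-! ### Reduction to the power `β` -/

/-- The weights `w` for which `∑ k ≤ K, w k * q ^ (K - k) = P K`. -/
def geomWeight (q : ℝ) (P : ℕ → ℝ) : ℕ → ℝ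
  | 0 => P 0
  | k + 1 => P (k + 1) - q * P k

/-- Raising `K` by one multiplies every old term by `(1 / 2) ^ β`; the new weight supplies the
difference. -/
theorem sum_geomWeight {β : ℝ} (P : ℕ → ℝ) (K : ℕ) :
    ∑ k ∈ Finset.range (K + 1), geomWeight ((1 / 2) ^ β) P k * (2 ^ k * (1 / 2) ^ K : ℝ) ^ β =
      P K := by
  induction K with
  | zero => simp [geomWeight]
  | succ K ih =>
    rw [Finset.sum_range_succ]
    have h1 : ∀ k, geomWeight ((1 / 2) ^ β) P k * (2 ^ k * (1 / 2) ^ (K + 1) : ℝ) ^ β =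
        (1 / 2 : ℝ) ^ β * (geomWeight ((1 / 2) ^ β) P k * (2 ^ k * (1 / 2) ^ K : ℝ) ^ β) := by
      intro k
      rw [pow_succ, ← mul_assoc, Real.mul_rpow (by positivity) (by norm_num)]
      ring
    rw [Finset.sum_congr rfl fun k _ => h1 k, ← Finset.mul_sum, ih, ← mul_pow]
    simp [geomWeight]

theorem IsDyadicallyRegular.borelReducible_rpow {β : ℝ} {F : ℝ → ℝ} (hβ : 0 < β)
    (hF : IsDyadicallyRegular ((1 / 2) ^ β) F) :
    BorelReducible (costRel fun x y : I => ENNReal.ofReal (F |(x : ℝ) - y|))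
      (costRel fun x y : ℝ => ENNReal.ofReal (|x - y| ^ β)) := by
  set q : ℝ := (1 / 2) ^ β
  have hq0 : 0 < q := hF.pos
  set P : ℕ → ℝ := fun k => F ((1 / 2) ^ k) with hP
  set w := geomWeight q P
  have hP0 : ∀ k, 0 < P k := hF.dyadic_pos
  have hw0 : ∀ k, 0 ≤ w k := fun k => by
    cases k with
    | zero => exact (hP0 0).le
    | succ k => exact sub_nonneg.2 (hF.mul_le k)
  have hwP : ∀ k, w k ≤ P k := fun k => by
    cases k with
    | zero => exact le_rfl
    | succ k => exact sub_le_self _ (mul_pos hq0 (hP0 k)).le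
  let H : ℕ → ℝ → ℝ≥0∞ := fun k s => ENNReal.ofReal (w k * s ^ β)
  have hH : ∀ k, MonotoneOn (H k) (Set.Ici 0) := fun k s hs t ht hst =>
    ENNReal.ofReal_le_ofReal (mul_le_mul_of_nonneg_left
      (Real.rpow_le_rpow hs hst hβ.le) (hw0 k))
  have hH0 : ∀ k, H k 0 = 0 := fun k => by simp [H, Real.zero_rpow hβ.ne']
  have hcost : ∀ x y : I, ∑' p : ℕ × Bool, ENNReal.ofReal
      (|w p.1 ^ β⁻¹ * wave p.2 (2 ^ p.1 * x) - w p.1 ^ β⁻¹ * wave p.2 (2 ^ p.1 * y)| ^ β) =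
      waveCost H x y := by
    intro x y
    refine tsum_congr fun p => ?_
    rw [← mul_sub, abs_mul, Real.mul_rpow (abs_nonneg _) (abs_nonneg _),
      abs_of_nonneg (Real.rpow_nonneg (hw0 _) _), Real.rpow_inv_rpow (hw0 _) hβ.ne']
  refine borelReducible_costRel (ι := ℕ × Bool)
    (fun p x => w p.1 ^ β⁻¹ * wave p.2 (2 ^ p.1 * x))
    (fun p => (continuous_const.mul
      ((continuous_wave _).comp (continuous_const.mul continuous_subtype_val))).measurable)
    -- `q ^ 4` pays for the four halvings in `le_waveCost`. In `4 / q`, two phases meet two sums of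
    -- size at most `P K`, and `1 / q` passes from `2^-K` to the actual distance.
    (c := ENNReal.ofReal (q ^ 4)) (C := ENNReal.ofReal (4 / q))
    (ENNReal.ofReal_pos.2 (by positivity)).ne' ENNReal.ofReal_ne_top
    (fun x y => ?_) (fun x y => ?_) <;> rw [hcost] <;> rcases eq_or_ne x y with rfl | hxy
  · simp [hF.zero]
  · obtain ⟨K, hK1, hK⟩ := exists_dyadic_bounds hxy
    refine le_trans ?_ (le_waveCost hH hK hK1.le)
    rw [← ENNReal.ofReal_mul (by positivity), ← ENNReal.ofReal_sum_of_nonneg fun k _ =>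
      mul_nonneg (hw0 k) (Real.rpow_nonneg (by positivity) _)]
    refine ENNReal.ofReal_le_ofReal ?_
    have h1 : ∀ k, w k * (2 ^ k * (1 / 2) ^ (K + 4) : ℝ) ^ β =
        q ^ 4 * (w k * (2 ^ k * (1 / 2) ^ K : ℝ) ^ β) := by
      intro k
      rw [pow_add, ← mul_assoc, Real.mul_rpow (by positivity) (by positivity),
        ← Real.rpow_pow_comm (by positivity)]
      ring
    rw [Finset.sum_congr rfl fun k _ => h1 k, ← Finset.mul_sum, sum_geomWeight]
    exact mul_le_mul_of_nonneg_left (hF.mono hK) (by positivity)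
  · rw [waveCost_self hH0]
    exact zero_le
  · obtain ⟨K, hK1, hK⟩ := exists_dyadic_bounds hxy
    refine (waveCost_le hH hK).trans ?_
    have h1 : ∑ k ∈ Finset.range (K + 1), H k (2 ^ k * (1 / 2) ^ K) = ENNReal.ofReal (P K) := by
      rw [← sum_geomWeight (β := β) P K, ENNReal.ofReal_sum_of_nonneg fun k _ =>
        mul_nonneg (hw0 k) (Real.rpow_nonneg (by positivity) _)]
    have h2 : ∑' j, H (j + (K + 1)) 1 ≤ ENNReal.ofReal (P K) := by
      rw [← tsum_ofReal_geometric (hP0 K).le]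
      refine ENNReal.tsum_le_tsum fun j => ENNReal.ofReal_le_ofReal ?_
      rw [Real.one_rpow, mul_one]
      refine (hwP _).trans ((hF.le_half_pow (K + 1) j).trans ?_)
      gcongr
      exact hF.le_half K
    rw [h1]
    refine (mul_le_mul_right (add_le_add_right h2 _) 2).trans ?_
    rw [← ENNReal.ofReal_add (hP0 K).le (hP0 K).le, ← ENNReal.ofReal_ofNat 2,
      ← ENNReal.ofReal_mul (by norm_num), ← ENNReal.ofReal_mul (by positivity)]
    refine ENNReal.ofReal_le_ofReal ?_
    have h3 : q * P K ≤ F |(x : ℝ) - y| := (hF.mul_le K).trans (hF.mono hK1.le)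
    rw [div_mul_eq_mul_div, le_div_iff₀ hq0]
    linarith

/-! ### Reduction of `ℓ₁` -/

theorem IsDyadicallyRegular.borelReducible_unitInterval {q : ℝ} {f : I → ℝ≥0} {F : ℝ → ℝ}
    (hF : IsDyadicallyRegular q F) (hf : ∀ x y : I, (f (unitAbsSub y x) : ℝ) = F |(x : ℝ) - y|) :
    BorelReducible (costRel fun x y : I => ENNReal.ofReal |(x : ℝ) - y|) (sumRel f) := by
  rw [sumRel_eq_costRel]
  have hq0 : 0 < q := hF.pos
  set P : ℕ → ℝ := fun k => F ((1 / 2) ^ k) with hP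
  have hP0 : ∀ k, 0 < P k := hF.dyadic_pos
  have hPle : ∀ k, P k ≤ (1 / 2) ^ k := fun k => by
    have := hF.le_half_pow 0 k
    simpa [hF.one, hP] using this
  -- The number of waves of frequency at most `2^k`. It is monotone because `P` at least halves, and
  -- since `P k ≤ 2^-k` it is at least 1, so rounding loses at most a factor 2.
  let M : ℕ → ℕ := fun k => ⌊(1 / 2) ^ k / P k⌋₊
  have hMmono : Monotone M := monotone_nat_of_le_succ fun k => by
    refine Nat.floor_le_floor ?_
    rw [div_le_div_iff₀ (hP0 _) (hP0 _), pow_succ]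
    have h1 : P (k + 1) ≤ P k / 2 := hF.le_half k
    have h2 : (0 : ℝ) < (1 / 2) ^ k := by positivity
    nlinarith
  have hMle : ∀ k, M k * P k ≤ (1 / 2) ^ k := fun k =>
    (le_div_iff₀ (hP0 k)).1 (Nat.floor_le (div_nonneg (by positivity) (hP0 k).le))
  have hleM : ∀ k, (1 / 2) ^ k ≤ 2 * (M k * P k) := fun k => by
    have h1 : 1 ≤ (1 / 2) ^ k / P k := (one_le_div (hP0 k)).2 (hPle k)
    have h2 : (1 / 2) ^ k / P k < M k + 1 := Nat.lt_floor_add_one _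
    have h3 : (1 : ℝ) ≤ M k := by exact_mod_cast Nat.le_floor (by simpa using h1)
    have h4 : (1 / 2) ^ k / P k ≤ 2 * M k := by linarith
    rw [div_le_iff₀ (hP0 k)] at h4
    linarith
  obtain ⟨m, hm0, hm1⟩ : ∃ m : ℕ → ℕ, m 0 = M 0 ∧ ∀ k, m (k + 1) = M (k + 1) - M k :=
    ⟨fun k => Nat.casesOn k (M 0) fun k => M (k + 1) - M k, rfl, fun _ => rfl⟩
  have hm : ∀ K, ∑ k ∈ Finset.range (K + 1), m k = M K := fun K => by
    induction K with
    | zero => simp [hm0]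
    | succ K ih =>
      rw [Finset.sum_range_succ, ih, hm1]
      exact Nat.add_sub_of_le (hMmono K.le_succ)
  have hmM : ∀ k, m k ≤ M k := fun k => by
    cases k with
    | zero => exact hm0.le
    | succ k => exact (hm1 k).trans_le (Nat.sub_le _ _)
  let H : ℕ → ℝ → ℝ≥0∞ := fun k s => (m k : ℝ≥0∞) * ENNReal.ofReal (F ((1 / 2) ^ k * s))
  have hH : ∀ k, MonotoneOn (H k) (Set.Ici 0) := fun k s _ t _ hst => by
    refine mul_le_mul_right (ENNReal.ofReal_le_ofReal (hF.mono ?_)) _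
    gcongr
  have hH0 : ∀ k, H k 0 = 0 := fun k => by simp [H, hF.zero]
  have hsum : ∀ K j, ∑ k ∈ Finset.range (K + 1), H k (2 ^ k * (1 / 2) ^ (K + j)) =
      ENNReal.ofReal (M K * P (K + j)) := fun K j => by
    have h1 : ∀ k, H k (2 ^ k * (1 / 2) ^ (K + j)) = (m k : ℝ≥0∞) * ENNReal.ofReal (P (K + j)) := by
      intro k
      simp only [H]
      rw [← mul_assoc, ← mul_pow]
      norm_num [hP]
    rw [Finset.sum_congr rfl fun k _ => h1 k, ← Finset.sum_mul, ← Nat.cast_sum, hm,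
      ENNReal.ofReal_mul (Nat.cast_nonneg _), ENNReal.ofReal_natCast]
  let v : ℕ × Bool → I → I := fun p x =>
    ⟨(1 / 2) ^ p.1 * wave p.2 (2 ^ p.1 * x), mul_nonneg (by positivity) (wave_mem _ _).1,
      mul_le_one₀ (pow_le_one₀ (by norm_num) (by norm_num)) (wave_mem _ _).1 (wave_mem _ _).2⟩
  -- Surplus indices get a constant map, which costs `F 0 = 0`.
  let g : (ℕ × Bool) × ℕ → I → I := fun p x => if p.2 < m p.1.1 then v p.1 x else 0
  have hg : ∀ p, Measurable (g p) := fun p => by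
    by_cases h : p.2 < m p.1.1
    · simp only [g, h, if_true]
      exact (Continuous.subtype_mk (continuous_const.mul
        ((continuous_wave _).comp (continuous_const.mul continuous_subtype_val))) _).measurable
    · simp only [g, h, if_false]
      exact measurable_const
  have hcost : ∀ x y : I, ∑' p, (f (unitAbsSub (g p y) (g p x)) : ℝ≥0∞) = waveCost H x y := by
    intro x y
    have h1 : ∀ a b : I, (f (unitAbsSub b a) : ℝ≥0∞) = ENNReal.ofReal (F |(a : ℝ) - b|) :=
      fun a b => by rw [← hf, ENNReal.ofReal_coe_nnreal]
    simp only [h1]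
    rw [ENNReal.tsum_prod (f := fun p j => ENNReal.ofReal (F |(g (p, j) x : ℝ) - g (p, j) y|))]
    refine tsum_congr fun p => ?_
    rw [tsum_eq_sum (s := Finset.range (m p.1)) fun j hj => by
      simp [g, Finset.mem_range.not.1 hj, hF.zero]]
    rw [Finset.sum_congr rfl (g := fun _ => ENNReal.ofReal (F ((1 / 2) ^ p.1 *
      |wave p.2 (2 ^ p.1 * x) - wave p.2 (2 ^ p.1 * y)|))) fun j hj => ?_]
    · rw [Finset.sum_const, Finset.card_range, nsmul_eq_mul]
    · simp only [g, v, Finset.mem_range.1 hj, if_true]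
      rw [← mul_sub, abs_mul, abs_of_pos (by positivity)]
  -- The `2` in `q ^ 4 / 2` is the rounding loss; `8` is two phases, two sums, and `2^-K ≤ 2 * |x -
  -- y|`.
  refine borelReducible_costRel g hg (c := ENNReal.ofReal (q ^ 4 / 2)) (C := ENNReal.ofReal 8)
    (ENNReal.ofReal_pos.2 (by positivity)).ne' ENNReal.ofReal_ne_top
    (fun x y => ?_) (fun x y => ?_) <;> rw [hcost] <;> rcases eq_or_ne x y with rfl | hxy
  · simp
  · obtain ⟨K, hK1, hK⟩ := exists_dyadic_bounds hxy
    refine le_trans ?_ (le_waveCost hH hK hK1.le)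
    rw [hsum, ← ENNReal.ofReal_mul (by positivity)]
    refine ENNReal.ofReal_le_ofReal ?_
    calc q ^ 4 / 2 * |(x : ℝ) - y| ≤ q ^ 4 / 2 * (2 * (M K * P K)) := by
          gcongr
          exact hK.trans (hleM K)
      _ = M K * (q ^ 4 * P K) := by ring
      _ ≤ M K * P (K + 4) := by
          gcongr
          exact hF.pow_mul_le K 4
  · rw [waveCost_self hH0]
    exact zero_le
  · obtain ⟨K, hK1, hK⟩ := exists_dyadic_bounds hxy
    refine (waveCost_le hH hK).trans ?_
    have h1 : ∑ k ∈ Finset.range (K + 1), H k (2 ^ k * (1 / 2) ^ K) ≤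
        ENNReal.ofReal ((1 / 2) ^ K) :=
      (hsum K 0).le.trans (ENNReal.ofReal_le_ofReal (hMle K))
    have h2 : ∑' j, H (j + (K + 1)) 1 ≤ ENNReal.ofReal ((1 / 2) ^ K) := by
      rw [← tsum_ofReal_geometric (a := (1 / 2) ^ K) (by positivity)]
      refine ENNReal.tsum_le_tsum fun j => ?_
      simp only [H, mul_one]
      rw [← ENNReal.ofReal_natCast, ← ENNReal.ofReal_mul (Nat.cast_nonneg _)]
      refine ENNReal.ofReal_le_ofReal ?_
      calc (m (j + (K + 1)) : ℝ) * P (j + (K + 1)) ≤ M (j + (K + 1)) * P (j + (K + 1)) := by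
            have := (hP0 (j + (K + 1))).le
            gcongr
            exact hmM _
        _ ≤ (1 / 2) ^ (j + (K + 1)) := hMle _
        _ = (1 / 2) ^ K / 2 / 2 ^ j := by
            rw [pow_add, pow_succ, one_div_pow (2 : ℝ) j]
            ring
    refine (mul_le_mul_right (add_le_add h1 h2) 2).trans ?_
    rw [← ENNReal.ofReal_add (by positivity) (by positivity), ← ENNReal.ofReal_ofNat 2,
      ← ENNReal.ofReal_mul (by norm_num), ← ENNReal.ofReal_mul (by norm_num)]
    refine ENNReal.ofReal_le_ofReal ?_
    rw [pow_succ] at hK1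
    linarith

/-! ### The functions `x ^ α * φ x` -/

/-- The term `i = 1` makes the maximum nonnegative, so either alternative keeps at least the share
`lam` of the previous value. -/
theorem IsRecursiveSeq.pos_and_mul_le {δ lam : ℝ} {u : ℕ → ℝ} (hu : IsRecursiveSeq δ lam u)
    (hδ : 0 < δ) (hlam0 : 0 < lam) (hlam1 : lam < 1) (n : ℕ) :
    0 < u n ∧ lam * u n ≤ u (n + 1) := by
  induction n with
  | zero => simp [hu.zero, hu.one, hlam1.le]
  | succ m ih =>
    have hm : 0 < u (m + 1) := (mul_pos hlam0 ih.1).trans_le ih.2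
    refine ⟨hm, ?_⟩
    rcases hu.step m with h | h
    · rw [h]
      exact mul_le_of_le_one_left hm.le hlam1.le
    · rw [h]
      refine le_add_of_nonneg_right (mul_nonneg (by linarith) ?_)
      refine le_trans ?_ (Finset.le_sup' _ (Finset.mem_Icc.2 ⟨le_rfl, Nat.le_add_left 1 m⟩))
      rw [hu.one, show m + 2 - 1 = m + 1 by omega]
      positivity

theorem unitAbsSub_eq_projIcc (x y : I) :
    unitAbsSub y x = Set.projIcc 0 1 zero_le_one |(x : ℝ) - y| := by
  rw [abs_sub_comm]
  exact (Set.projIcc_of_mem zero_le_one (unitAbsSub y x).2).symm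

theorem isDyadicallyRegular_powMul {α β δ lam : ℝ} (hα : 1 ≤ α) (hαβ : α < β) (hδ : 0 < δ)
    (hlam : lam = (2 : ℝ) ^ (α - β)) {u : ℕ → ℝ} (hu : IsRecursiveSeq δ lam u)
    {φ : I → ℝ≥0} (hφm : Monotone φ) (hφ : ∀ n : ℕ, (φ (dyadicPoint n) : ℝ) = u n) :
    IsDyadicallyRegular ((1 / 2) ^ β)
      fun t => (powMul α φ (Set.projIcc 0 1 zero_le_one t) : ℝ) := by
  have hα0 : 0 < α := by linarith
  have hlam0 : 0 < lam := hlam ▸ by positivity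
  have hlam1 : lam < 1 := hlam ▸ Real.rpow_lt_one_of_one_lt_of_neg (by norm_num) (by linarith)
  have hu' := hu.pos_and_mul_le hδ hlam0 hlam1
  have hmono : Monotone (powMul α φ) := fun x y h =>
    mul_le_mul' (NNReal.rpow_le_rpow h hα0.le) (hφm h)
  have hproj : ∀ k, Set.projIcc (0 : ℝ) 1 zero_le_one ((1 / 2) ^ k) = dyadicPoint k := by
    intro k
    rw [one_div_pow]
    exact Set.projIcc_of_mem zero_le_one (dyadicPoint k).2
  have hval : ∀ k, (powMul α φ (Set.projIcc 0 1 zero_le_one ((1 / 2) ^ k)) : ℝ) =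
      ((1 / 2) ^ α) ^ k * u k := by
    intro k
    rw [hproj, powMul, NNReal.coe_mul, NNReal.coe_rpow, hφ, Real.rpow_pow_comm (by norm_num),
      one_div_pow]
    rfl
  have hanti : ∀ k, u (k + 1) ≤ u k := by
    intro k
    rw [← hφ, ← hφ]
    refine hφm (Subtype.coe_le_coe.1 ?_)
    simp only [dyadicPoint]
    gcongr
    · norm_num
    · exact k.le_succ
  have hlamα : (1 / 2 : ℝ) ^ β = (1 / 2) ^ α * lam := by
    rw [hlam, one_div, Real.inv_rpow (by norm_num), Real.inv_rpow (by norm_num),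
      ← Real.rpow_neg (by norm_num), ← Real.rpow_neg (by norm_num),
      ← Real.rpow_add (by norm_num)]
    congr 1
    ring
  have hhalf : (1 / 2 : ℝ) ^ α ≤ 1 / 2 := by
    simpa using Real.rpow_le_rpow_of_exponent_ge (x := 1 / 2) (by norm_num) (by norm_num) hα
  refine ⟨by positivity, fun s t h => ?_, ?_, ?_, fun k => ?_, fun k => ?_⟩
  · exact NNReal.coe_le_coe.2 (hmono (Set.monotone_projIcc _ h))
  · simp [powMul, NNReal.zero_rpow hα0.ne']
  · simpa [hu.zero] using hval 0
  · simp only [hval]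
    rw [hlamα, pow_succ]
    have := mul_le_mul_of_nonneg_left (hu' k).2
      (show (0 : ℝ) ≤ ((1 / 2) ^ α) ^ k * (1 / 2) ^ α by positivity)
    linarith
  · simp only [hval]
    rw [pow_succ, mul_assoc, mul_div_assoc]
    refine mul_le_mul_of_nonneg_left ?_ (by positivity)
    have := hanti k
    have := (hu' (k + 1)).1
    nlinarith

theorem mainTheorem2 (α β δ lam : ℝ) (hα : 1 ≤ α) (hαβ : α < β) (hδ0 : 0 < δ) (hδ1 : δ < 1)
    (hlam : lam = (2 : ℝ) ^ (α - β)) (u : ℕ → ℝ) (hu : IsRecursiveSeq δ lam u)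
    (φ : I → ℝ≥0) (hφc : Continuous φ) (hφm : Monotone φ)
    (hφ : ∀ n : ℕ, (φ (dyadicPoint n) : ℝ) = u n) :
    Equivalence (sumRel (powMul α φ)) ∧
      BorelReducible (lpRel 1) (sumRel (powMul α φ)) ∧
      BorelReducible (sumRel (powMul α φ)) (lpRel (ENNReal.ofReal β)) := by
  have hF := isDyadicallyRegular_powMul hα hαβ hδ0 hlam hu hφm hφ
  have hβ : 0 < β := by linarith
  have hred : BorelReducible (sumRel (powMul α φ)) (lpRel (ENNReal.ofReal β)) := by
    rw [sumRel_eq_costRel, lpRel_eq_costRel hβ]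
    simp only [unitAbsSub_eq_projIcc, ← ENNReal.ofReal_coe_nnreal]
    exact hF.borelReducible_rpow hβ
  -- Being an equivalence relation is pulled back from `ℓ_β` along the reduction.
  refine ⟨hred.equivalence (equivalence_lpRel _), ?_, hred⟩
  exact borelReducible_lpRel_one_unitInterval.trans
    (hF.borelReducible_unitInterval fun x y => by rw [unitAbsSub_eq_projIcc])
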